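/- Let $d\ge 1$. Let $\mathcal X$ be the space of continuous maps $x:\mathbb R\times\mathbb R\to\mathbb R^d$, $(s,t)\mapsto x_{st}$, with $x_{tt}=0$ and $x_{su}+x_{ut}=x_{st}$ for all $s,u,t$, with the $\sigma$-algebra generated by the coordinates $X_{st}(x)=x_{st}$. Let $\mu$ be the law on $\mathcal X$ of the increments $X_{st}=B_t-B_s$ of a two-sided standard $d$-dimensional Brownian motion $B$. Let $W:\mathbb R^d\times\mathbb R\to\mathbb R$ be continuous, put $$U_{[a,b]}(x)=\int_a^b\!\int_a^b W(x_{st},t-s)\,ds\,dt,\qquad H_T=U_{[-T,T]},$$ and assume that there is $C<\infty$ with $|U_{[a,b]}(x)|\le C(b-a)^2$ for all $a\le b$ and all $x\in\mathcal X$. For $\lambda\in\mathbb R$ and $T>0$ let $\mu_{\lambda,T}$ be the probability measure $$\mu_{\lambda,T}(dx)=Z_{\lambda,T}^{-1}\,e^{-\lambda H_T(x)}\,\mu(dx),\qquad Z_{\lambda,T}=\int_{\mathcal X} e^{-\lambda H_T}\,d\mu .$$ Assume (H4): $W(\cdot,t)$ is twice continuously differentiable for every $t$, and for some $K<\infty$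 and some $\alpha>3$, $$\sup_{\xi\in\mathbb R^d}|\nabla_\xi\nabla_\xi W(\xi,t)|\le \frac{K}{(1+|t|)^{\alpha}}\qquad\text{for all } t\in\mathbb R .$$ Then for every $\lambda\in\mathbb R$ there is a constant $\sigma_->0$ such that for all $T>0$ and all $a,b\in\mathbb R$ the variable $|X_{ab}|^2$ is $\mu_{\lambda,T}$-integrable and $$\mathbb E^{\mu_{\lambda,T}}\big[|X_{ab}|^2\big]\ \ge\ \sigma_-^2\,|a-b| ,$$ and likewise, for every unit vector $v\in\mathbb R^d$, $$\mathbb E^{\mu_{\lambda,T}}\big[\langle v,X_{ab}\rangle^2\big]\ \ge\ \sigma_-^2\,|a-b| .$$ -/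

import Mathlib

open MeasureTheory ProbabilityTheory

/-- The space of continuous increment paths in `ℝ^d`: continuous maps `x : ℝ × ℝ → ℝ^d` with
`x_tt = 0` and `x_su + x_ut = x_st`. As a subtype of `ℝ → ℝ → ℝ^d` it carries the σ-algebra
generated by the coordinates (the increments) `x ↦ x_st`. -/
abbrev IncrPath (d : ℕ) : Type :=
  {x : ℝ → ℝ → EuclideanSpace ℝ (Fin d) //
    Continuous (Function.uncurry x) ∧ (∀ t, x t t = 0) ∧ ∀ s u t, x s u + x u t = x s t}

/-- The coordinate process `X_st` on the space of increment paths. -/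
def incr {d : ℕ} (s t : ℝ) (x : IncrPath d) : EuclideanSpace ℝ (Fin d) := x.1 s t

/-- `μ` is the law of the increments `X_st = B_t - B_s` of a (two-sided) standard
`d`-dimensional Brownian motion: `X_st` has law `N(0, |t - s| Id)`, that is, every one-dimensional
projection `⟨v, X_st⟩` has law `N(0, |v|² |t - s|)`, and the increments over successive intervals
are mutually independent. These properties determine `μ` uniquely. -/
structure IsWienerIncrementMeasure {d : ℕ} (μ : Measure (IncrPath d)) : Prop where
  gaussian : ∀ (s t : ℝ) (v : EuclideanSpace ℝ (Fin d)),
    μ.map (fun x => inner ℝ v (incr s t x)) = gaussianReal 0 (‖v‖₊ ^ 2 * ‖t - s‖₊)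
  indep : ∀ (n : ℕ) (t : Fin (n + 1) → ℝ), Monotone t →
    iIndepFun (fun (i : Fin n) (x : IncrPath d) => incr (t i.castSucc) (t i.succ) x) μ

/-- The energy `U_[a,b](x) = ∫_a^b ∫_a^b W(x_st, t - s) ds dt` of the path `x` in the interval
`[a,b]` (meant for `a ≤ b`). -/
noncomputable def pathEnergy {d : ℕ} (W : EuclideanSpace ℝ (Fin d) → ℝ → ℝ) (a b : ℝ)
    (x : IncrPath d) : ℝ :=
  ∫ t in a..b, ∫ s in a..b, W (incr s t x) (t - s)

/-- The energy in an interval `I` is bounded by `C |I|²`, uniformly over all paths. -/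
def EnergyBounded {d : ℕ} (W : EuclideanSpace ℝ (Fin d) → ℝ → ℝ) : Prop :=
  ∃ C : ℝ, ∀ a b : ℝ, a ≤ b → ∀ x : IncrPath d, |pathEnergy W a b x| ≤ C * (b - a) ^ 2

/-- `W(·, t)` is `C²` and its Hessian is bounded, uniformly in space, by `K (1 + |t|)^(-α)` for
some `K < ∞` and `α > 3`. -/
def HessianDecay {d : ℕ} (W : EuclideanSpace ℝ (Fin d) → ℝ → ℝ) : Prop :=
  (∀ t : ℝ, ContDiff ℝ 2 (fun ξ => W ξ t)) ∧
  ∃ K α : ℝ, 3 < α ∧ ∀ (t : ℝ) (ξ : EuclideanSpace ℝ (Fin d)),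
    ‖fderiv ℝ (fderiv ℝ (fun η => W η t)) ξ‖ ≤ K / (1 + |t|) ^ α

/-- The finite-volume measure `μ_{lam,T}(dx) = Z⁻¹ exp(-lam H_T(x)) μ(dx)`, where `H_T = U_[-T,T]`
and `Z = ∫ exp(-lam H_T) dμ`. -/
noncomputable def finiteVolumeMeasure {d : ℕ} (μ : Measure (IncrPath d))
    (W : EuclideanSpace ℝ (Fin d) → ℝ → ℝ) (lam T : ℝ) : Measure (IncrPath d) :=
  μ.tilted (fun x => -lam * pathEnergy W (-T) T x)

/-!
Let `F x = ⟨v, X_ab x⟩` with `‖v‖ = 1` and `a < b`, and let `h = ramp a b • v`. The increment `F` is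
the Wiener integral of the derivative of `h`, so the Cameron-Martin formula for the translation
`x ↦ x + r h` of a path has density `exp (r F - r² (b - a) / 2)`
(`IsWienerIncrementMeasure.lintegral_comp_shiftPath`). It is proved by subtracting
`(F / (b - a)) • h` from the path: the remaining bridge is jointly Gaussian with `F` and
uncorrelated with it, hence independent of `F` (`IsWienerIncrementMeasure.indepFun_shiftPath`), and
the claim reduces to a translation of a Gaussian on the real line.

The symmetric second difference of the energy is small:
`H_T(x + r h) + H_T(x - r h) - 2 H_T(x)` is at most `r² A (b - a)` in absolute value, where `A` does
not depend on `T`, `a`, `b`, `x`, `v` (`abs_pathEnergy_second_difference_le`). Indeed the integrand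
is at most `2 K (1 + |t - s|)^(-α) ‖h t - h s‖²`, and integrating over `s` at fixed `u = t - s`
gives at most `2 K (1 + |u|)^(-α) u² (b - a)`, which is integrable in `u` because `α > 3`.

By the inequality of arithmetic and geometric means, `exp (-lam H_T(x))` is, up to a factor
`exp (|lam| A (b - a) r² / 2)`, at most the mean of its values at `x ± r h` with weights
`exp (∓ k F(x))`. Applying Cameron-Martin to both terms gives, for suitable `r` and `k`,
`E[cosh (δ F)] ≥ exp (δ² (b - a) / (2 (1 + |lam| A)))` under `μ_{lam,T}`
(`IsWienerIncrementMeasure.exp_mul_lintegral_le`). Comparing terms of order `δ²` as `δ → 0` yields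
`E[F²] ≥ (b - a) / (1 + |lam| A)`.
-/

/-! ### Second differences of functions with bounded Hessian -/

/-- The mean value inequality is applied to `r ↦ f (ξ + r η) + f (ξ - r η)` on `[0, 1]`. This
loses a factor `2` against Taylor's formula. -/
theorem abs_second_difference_le {E : Type*} [NormedAddCommGroup E] [NormedSpace ℝ E]
    {f : E → ℝ} (hf : ContDiff ℝ 2 f) {K : ℝ} (hK : ∀ ξ, ‖fderiv ℝ (fderiv ℝ f) ξ‖ ≤ K)
    (ξ η : E) : |f (ξ + η) + f (ξ - η) - 2 * f ξ| ≤ 2 * K * ‖η‖ ^ 2 := by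
  have hK0 : 0 ≤ K := (norm_nonneg (fderiv ℝ (fderiv ℝ f) 0)).trans (hK 0)
  have hd : Differentiable ℝ f := hf.differentiable (by norm_num)
  have hd' : Differentiable ℝ (fderiv ℝ f) :=
    (hf.fderiv_right (m := 1) (by norm_num)).differentiable (by norm_num)
  have hlip : ∀ p q, ‖fderiv ℝ f p - fderiv ℝ f q‖ ≤ K * ‖p - q‖ := fun p q ↦
    Convex.norm_image_sub_le_of_norm_fderiv_le (fun z _ ↦ hd'.differentiableAt) (fun z _ ↦ hK z)
      convex_univ (Set.mem_univ q) (Set.mem_univ p)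
  have hder : ∀ r : ℝ, HasDerivAt (fun r : ℝ ↦ f (ξ + r • η) + f (ξ - r • η))
      ((fderiv ℝ f (ξ + r • η) - fderiv ℝ f (ξ - r • η)) η) r := by
    intro r
    have h1 : HasDerivAt (fun r : ℝ ↦ ξ + r • η) η r := by
      simpa using ((hasDerivAt_id r).smul_const η).const_add ξ
    have h2 : HasDerivAt (fun r : ℝ ↦ ξ - r • η) (-η) r := by
      simpa using ((hasDerivAt_id r).smul_const η).const_sub ξ
    refine (((hd (ξ + r • η)).hasFDerivAt.comp_hasDerivAt r h1).add
      ((hd (ξ - r • η)).hasFDerivAt.comp_hasDerivAt r h2)).congr_deriv ?_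
    simp [sub_eq_add_neg]
  have := norm_image_sub_le_of_norm_deriv_le_segment_01' (C := 2 * K * ‖η‖ ^ 2)
    (fun r _ ↦ (hder r).hasDerivWithinAt) (fun r hr ↦ ?_)
  · have h3 : f (ξ + (1 : ℝ) • η) + f (ξ - (1 : ℝ) • η)
        - (f (ξ + (0 : ℝ) • η) + f (ξ - (0 : ℝ) • η)) = f (ξ + η) + f (ξ - η) - 2 * f ξ := by
      simp; ring
    rwa [h3] at this
  · refine (ContinuousLinearMap.le_opNorm _ _).trans ?_
    have h4 : ‖fderiv ℝ f (ξ + r • η) - fderiv ℝ f (ξ - r • η)‖ ≤ K * (2 * ‖η‖) := by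
      refine (hlip _ _).trans ?_
      gcongr
      have : ξ + r • η - (ξ - r • η) = (2 * r) • η := by module
      rw [this, norm_smul, Real.norm_eq_abs, abs_of_nonneg (by linarith [hr.1])]
      have := norm_nonneg η
      nlinarith [hr.2]
    nlinarith [norm_nonneg η]

/-! ### The ramp -/

/-- The path with slope one on `[a, b]` that is constant outside of `[a, b]`. -/
def ramp (a b t : ℝ) : ℝ := max a (min t b)

theorem continuous_ramp (a b : ℝ) : Continuous (ramp a b) := by
  unfold ramp; fun_prop

theorem monotone_ramp (a b : ℝ) : Monotone (ramp a b) := fun s t h ↦ by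
  unfold ramp; gcongr

theorem le_ramp (a b t : ℝ) : a ≤ ramp a b t := le_max_left _ _

theorem ramp_le {a b : ℝ} (hab : a ≤ b) (t : ℝ) : ramp a b t ≤ b :=
  max_le hab (min_le_right _ _)

theorem abs_ramp_sub_le (a b s t : ℝ) : |ramp a b t - ramp a b s| ≤ |t - s| := by
  unfold ramp
  refine (abs_max_sub_max_le_max _ _ _ _).trans (max_le (by simp) ?_)
  exact (abs_min_sub_min_le_max _ _ _ _).trans (max_le le_rfl (by simp))

/-- By monotonicity of the ramp the integral telescopes to the difference of two integrals over
intervals of length `|u|`. -/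
theorem integral_abs_ramp_add_sub_le {a b : ℝ} (hab : a ≤ b) (T u : ℝ) :
    ∫ s in -T..T, |ramp a b (s + u) - ramp a b s| ≤ |u| * (b - a) := by
  have hc := continuous_ramp a b
  have hi : ∀ p q : ℝ, IntervalIntegrable (ramp a b) volume p q := fun p q ↦
    hc.intervalIntegrable p q
  have hJ : ∫ s in -T..T, (ramp a b (s + u) - ramp a b s)
      = (∫ s in T..T + u, ramp a b s) - ∫ s in -T..-T + u, ramp a b s := by
    rw [intervalIntegral.integral_sub
      (Continuous.intervalIntegrable (by fun_prop) _ _) (hi _ _),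
      intervalIntegral.integral_comp_add_right (fun s ↦ ramp a b s) u]
    have h1 := intervalIntegral.integral_add_adjacent_intervals (hi (-T) T) (hi T (T + u))
    have h2 := intervalIntegral.integral_add_adjacent_intervals (hi (-T) (-T + u)) (hi _ (T + u))
    linarith
  have hub : ∀ p q : ℝ, p ≤ q → ∫ s in p..q, ramp a b s ≤ (q - p) * b := fun p q h ↦ by
    simpa using intervalIntegral.integral_mono_on h (hi p q)
      (intervalIntegrable_const (c := b)) (fun s _ ↦ ramp_le hab s)
  have hlb : ∀ p q : ℝ, p ≤ q → (q - p) * a ≤ ∫ s in p..q, ramp a b s := fun p q h ↦ by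
    simpa using intervalIntegral.integral_mono_on h
      (intervalIntegrable_const (c := a)) (hi p q) (fun s _ ↦ le_ramp a b s)
  rcases le_total 0 u with hu | hu
  · have : ∀ s, |ramp a b (s + u) - ramp a b s| = ramp a b (s + u) - ramp a b s := fun s ↦
      abs_of_nonneg (sub_nonneg.2 (monotone_ramp a b (by linarith)))
    simp_rw [this]
    rw [hJ, abs_of_nonneg hu]
    have := hub T (T + u) (by linarith)
    have := hlb (-T) (-T + u) (by linarith)
    linarith
  · have : ∀ s, |ramp a b (s + u) - ramp a b s| = -(ramp a b (s + u) - ramp a b s) := fun s ↦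
      abs_of_nonpos (sub_nonpos.2 (monotone_ramp a b (by linarith)))
    simp_rw [this]
    rw [intervalIntegral.integral_neg, hJ, abs_of_nonpos hu, intervalIntegral.integral_symm (T + u),
      intervalIntegral.integral_symm (-T + u)]
    have := hub (T + u) T (by linarith)
    have := hlb (-T + u) (-T) (by linarith)
    linarith

/-- The estimate is uniform in `T`: at fixed `u = t - s` one factor of the squared ramp increment is
at most `|u|`, and the integral over `s` of the other one is at most `|u| (b - a)`. -/
theorem integral_integral_mul_ramp_sub_sq_le {a b : ℝ} (hab : a ≤ b) {T : ℝ} (hT : 0 ≤ T)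
    {g : ℝ → ℝ} (hg : Continuous g) (hg0 : ∀ u, 0 ≤ g u)
    (hgi : Integrable fun u ↦ g u * u ^ 2) :
    ∫ t in -T..T, ∫ s in -T..T, g (t - s) * (ramp a b t - ramp a b s) ^ 2
      ≤ (∫ u, g u * u ^ 2) * (b - a) := by
  have hc := continuous_ramp a b
  let φ : ℝ → ℝ → ℝ := fun u s ↦ g u * |u| * |ramp a b (s + u) - ramp a b s|
  have hφ : Continuous (Function.uncurry φ) := by
    simp only [φ, Function.uncurry_def]; fun_prop
  have hφ0 : ∀ u s, 0 ≤ φ u s := fun u s ↦ by have := hg0 u; positivity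
  have hψ : Continuous (Function.uncurry fun t s ↦ φ (t - s) s) := by
    simp only [Function.uncurry_def]
    exact hφ.comp (by fun_prop : Continuous fun p : ℝ × ℝ ↦ (p.1 - p.2, p.2))
  have hTT : -T ≤ T := by linarith
  have swap : ∀ (f : ℝ → ℝ → ℝ), Continuous (Function.uncurry f) → ∀ p q p' q',
      ∫ t in p..q, ∫ s in p'..q', f t s = ∫ s in p'..q', ∫ t in p..q, f t s :=
    fun f hf p q p' q' ↦ intervalIntegral_intervalIntegral_swap
      (by
        exact (hf.continuousOn.integrableOn_compact (isCompact_uIcc.prod isCompact_uIcc)).mono_set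
          (Set.prod_mono Set.uIoc_subset_uIcc Set.uIoc_subset_uIcc))
  have cont : ∀ (f : ℝ → ℝ → ℝ), Continuous (Function.uncurry f) → ∀ p q,
      Continuous fun t ↦ ∫ s in p..q, f t s := fun f hf p q ↦
    intervalIntegral.continuous_parametric_intervalIntegral_of_continuous' hf p q
  calc ∫ t in -T..T, ∫ s in -T..T, g (t - s) * (ramp a b t - ramp a b s) ^ 2
      ≤ ∫ t in -T..T, ∫ s in -T..T, φ (t - s) s := by
        have hf : Continuous (Function.uncurry
            fun t s ↦ g (t - s) * (ramp a b t - ramp a b s) ^ 2) := by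
          simp only [Function.uncurry_def]; fun_prop
        refine intervalIntegral.integral_mono_on hTT ((cont _ hf _ _).intervalIntegrable _ _)
          ((cont _ hψ _ _).intervalIntegrable _ _) fun t _ ↦ ?_
        refine intervalIntegral.integral_mono_on hTT
          (Continuous.intervalIntegrable (by fun_prop) _ _)
          (Continuous.intervalIntegrable (by simp only [φ]; fun_prop) _ _) fun s _ ↦ ?_
        simp only [φ, add_sub_cancel, mul_assoc]
        gcongr
        · exact hg0 _
        rw [← sq_abs, sq]
        exact mul_le_mul_of_nonneg_right (abs_ramp_sub_le a b s t) (abs_nonneg _)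
    _ = ∫ s in -T..T, ∫ t in -T..T, φ (t - s) s := swap _ hψ _ _ _ _
    _ ≤ ∫ s in -T..T, ∫ u in -(2 * T)..2 * T, φ u s := by
        have hφ' : Continuous (Function.uncurry fun s u ↦ φ u s) := hφ.comp continuous_swap
        have hψ' : Continuous (Function.uncurry fun s t ↦ φ (t - s) s) := hψ.comp continuous_swap
        refine intervalIntegral.integral_mono_on hTT ((cont _ hψ' _ _).intervalIntegrable _ _)
          ((cont _ hφ' _ _).intervalIntegrable _ _) fun s hs ↦ ?_
        -- substitute `u = t - s` and enlarge the interval to one independent of `s`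
        rw [intervalIntegral.integral_comp_sub_right (fun u ↦ φ u s) s]
        refine intervalIntegral.integral_mono_interval (by linarith [hs.2]) (by linarith)
          (by linarith [hs.1]) (Filter.Eventually.of_forall fun u ↦ hφ0 u s)
          (Continuous.intervalIntegrable (by simp only [φ]; fun_prop) _ _)
    _ = ∫ u in -(2 * T)..2 * T, ∫ s in -T..T, φ u s := (swap _ hφ _ _ _ _).symm
    _ ≤ ∫ u in -(2 * T)..2 * T, g u * u ^ 2 * (b - a) := by
        refine intervalIntegral.integral_mono_on (by linarith)
          ((cont _ hφ _ _).intervalIntegrable _ _)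
          (Continuous.intervalIntegrable (by fun_prop) _ _) fun u _ ↦ ?_
        simp only [φ, intervalIntegral.integral_const_mul]
        calc _ ≤ g u * |u| * (|u| * (b - a)) := by
              have := hg0 u
              gcongr
              exact integral_abs_ramp_add_sub_le hab T u
          _ = g u * u ^ 2 * (b - a) := by rw [← sq_abs]; ring
    _ ≤ (∫ u, g u * u ^ 2) * (b - a) := by
        rw [intervalIntegral.integral_mul_const, intervalIntegral.integral_of_le (by linarith)]
        exact mul_le_mul_of_nonneg_right (setIntegral_le_integral hgi
          (Filter.Eventually.of_forall fun u ↦ mul_nonneg (hg0 u) (sq_nonneg u))) (by linarith)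

theorem integrable_mul_one_add_abs_rpow_mul_sq (K : ℝ) {α : ℝ} (hα : 3 < α) :
    Integrable fun u : ℝ ↦ 2 * (K / (1 + |u|) ^ α) * u ^ 2 := by
  have h := (integrable_one_add_norm (E := ℝ) (μ := volume) (r := α - 2)
    (by simp; linarith)).const_mul (2 * |K|)
  refine h.mono' (Measurable.aestronglyMeasurable (by fun_prop))
    (Filter.Eventually.of_forall fun u ↦ ?_)
  have hu : 0 < 1 + |u| := by positivity
  rw [Real.norm_eq_abs, abs_mul, abs_mul, abs_div, abs_of_pos (Real.rpow_pos_of_pos hu α),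
    Real.norm_eq_abs, neg_sub, Real.rpow_sub hu, abs_of_nonneg (sq_nonneg u), abs_two]
  have : u ^ 2 ≤ (1 + |u|) ^ (2 : ℝ) := by
    rw [Real.rpow_two, ← sq_abs u]; gcongr; linarith
  calc 2 * (|K| / (1 + |u|) ^ α) * u ^ 2 ≤ 2 * (|K| / (1 + |u|) ^ α) * (1 + |u|) ^ (2 : ℝ) := by
        gcongr
    _ = _ := by ring

section IncrPath

variable {d : ℕ}

/-! ### Increment paths and their translates -/

/-- The translate of the increment path `x` by `r` times the path `ramp a b` in direction `v`. -/
def shiftPath (a b : ℝ) (v : EuclideanSpace ℝ (Fin d)) (r : ℝ) (x : IncrPath d) : IncrPath d :=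
  ⟨fun s t ↦ x.1 s t + (r * (ramp a b t - ramp a b s)) • v, by
    obtain ⟨x, hc, h0, hadd⟩ := x
    have := continuous_ramp a b
    refine ⟨?_, fun t ↦ by simp [h0], fun s u t ↦ ?_⟩
    · simp only [Function.uncurry_def] at hc ⊢
      fun_prop
    · simp only [← hadd s u t]
      module⟩

theorem incr_shiftPath (a b : ℝ) (v : EuclideanSpace ℝ (Fin d)) (r s t : ℝ) (x : IncrPath d) :
    incr s t (shiftPath a b v r x) = incr s t x + (r * (ramp a b t - ramp a b s)) • v := rfl

theorem incr_ext {x y : IncrPath d} (h : ∀ s t, incr s t x = incr s t y) : x = y :=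
  Subtype.ext (funext fun s ↦ funext fun t ↦ h s t)

theorem shiftPath_shiftPath (a b : ℝ) (v : EuclideanSpace ℝ (Fin d)) (r r' : ℝ) (x : IncrPath d) :
    shiftPath a b v r (shiftPath a b v r' x) = shiftPath a b v (r + r') x :=
  incr_ext fun s t ↦ by simp only [incr_shiftPath]; module

theorem incr_self (t : ℝ) (x : IncrPath d) : incr t t x = 0 := x.2.2.1 t

theorem incr_add_incr (s u t : ℝ) (x : IncrPath d) : incr s u x + incr u t x = incr s t x :=
  x.2.2.2 s u t

theorem incr_symm (s t : ℝ) (x : IncrPath d) : incr t s x = -incr s t x :=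
  eq_neg_of_add_eq_zero_left (by rw [incr_add_incr, incr_self])

theorem continuous_incr (x : IncrPath d) : Continuous fun p : ℝ × ℝ ↦ incr p.1 p.2 x := x.2.1

@[fun_prop]
theorem measurable_incr (s t : ℝ) : Measurable (incr (d := d) s t) :=
  (measurable_pi_apply t).comp ((measurable_pi_apply s).comp measurable_subtype_coe)

theorem measurable_incr_uncurry :
    Measurable fun p : (ℝ × ℝ) × IncrPath d ↦ incr p.1.1 p.1.2 p.2 :=
  measurable_uncurry_of_continuous_of_measurable
    (u := fun (p : ℝ × ℝ) (x : IncrPath d) ↦ incr p.1 p.2 x) continuous_incr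
    fun p ↦ measurable_incr p.1 p.2

theorem measurable_of_incr {Ω : Type*} [MeasurableSpace Ω] {f : Ω → IncrPath d}
    (h : ∀ s t, Measurable fun ω ↦ incr s t (f ω)) : Measurable f :=
  (measurable_pi_lambda _ fun s ↦ measurable_pi_lambda _ fun t ↦ h s t).subtype_mk

theorem measurable_shiftPath (a b : ℝ) (v : EuclideanSpace ℝ (Fin d)) :
    Measurable fun p : IncrPath d × ℝ ↦ shiftPath a b v p.2 p.1 :=
  measurable_of_incr fun s t ↦ by
    simp only [incr_shiftPath]
    have := measurable_incr (d := d) s t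
    fun_prop

/-! ### Second differences of the energy -/

theorem continuous_pathEnergy_integrand {W : EuclideanSpace ℝ (Fin d) → ℝ → ℝ}
    (hW : Continuous (Function.uncurry W)) (x : IncrPath d) :
    Continuous fun p : ℝ × ℝ ↦ W (incr p.2 p.1 x) (p.1 - p.2) :=
  hW.comp (((continuous_incr x).comp continuous_swap).prodMk (by fun_prop))

theorem measurable_pathEnergy {W : EuclideanSpace ℝ (Fin d) → ℝ → ℝ}
    (hW : Continuous (Function.uncurry W)) (a b : ℝ) : Measurable (pathEnergy W a b) := by
  have h1 : StronglyMeasurable fun p : (IncrPath d × ℝ) × ℝ ↦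
      W (incr p.2 p.1.2 p.1.1) (p.1.2 - p.2) := by
    refine Measurable.stronglyMeasurable (hW.measurable.comp (Measurable.prodMk ?_ (by fun_prop)))
    exact measurable_incr_uncurry.comp
      (by fun_prop : Measurable fun p : (IncrPath d × ℝ) × ℝ ↦ ((p.2, p.1.2), p.1.1))
  have h2 : StronglyMeasurable fun p : IncrPath d × ℝ ↦
      ∫ s in a..b, W (incr s p.2 p.1) (p.2 - s) := by
    simp only [intervalIntegral]
    exact h1.integral_prod_right.sub h1.integral_prod_right
  unfold pathEnergy
  simp only [intervalIntegral.eq_1 (fun t ↦ ∫ s in a..b, W (incr s t _) (t - s))]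
  exact (h2.integral_prod_right.sub h2.integral_prod_right).measurable

/-- The second difference of the energy in the direction of the ramp. The bound is proportional to
the length of `[a, b]`, uniformly in the volume `T`. -/
theorem abs_pathEnergy_second_difference_le {W : EuclideanSpace ℝ (Fin d) → ℝ → ℝ}
    (hW : Continuous (Function.uncurry W)) (hC : ∀ t : ℝ, ContDiff ℝ 2 fun ξ ↦ W ξ t) {K α : ℝ}
    (hα : 3 < α) (hK : ∀ (t : ℝ) (ξ : EuclideanSpace ℝ (Fin d)),
      ‖fderiv ℝ (fderiv ℝ (fun η ↦ W η t)) ξ‖ ≤ K / (1 + |t|) ^ α)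
    {a b : ℝ} (hab : a ≤ b) {T : ℝ} (hT : 0 ≤ T) {v : EuclideanSpace ℝ (Fin d)} (hv : ‖v‖ = 1)
    (r : ℝ) (x : IncrPath d) :
    |pathEnergy W (-T) T (shiftPath a b v r x) + pathEnergy W (-T) T (shiftPath a b v (-r) x)
        - 2 * pathEnergy W (-T) T x|
      ≤ r ^ 2 * ((∫ u : ℝ, 2 * (K / (1 + |u|) ^ α) * u ^ 2) * (b - a)) := by
  have hTT : -T ≤ T := by linarith
  have hc := continuous_ramp a b
  have hK0 : ∀ u, 0 ≤ 2 * (K / (1 + |u|) ^ α) := fun u ↦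
    mul_nonneg zero_le_two ((norm_nonneg (fderiv ℝ (fderiv ℝ fun η ↦ W η u) 0)).trans (hK u 0))
  have hg : Continuous fun u : ℝ ↦ 2 * (K / (1 + |u|) ^ α) := by
    have : ∀ u : ℝ, 0 < 1 + |u| := fun u ↦ by positivity
    refine continuous_const.mul
      (continuous_const.div₀ ?_ fun u ↦ (Real.rpow_pos_of_pos (this u) α).ne')
    exact Continuous.rpow_const (by fun_prop) fun u ↦ Or.inl (this u).ne'
  -- the integrand of each energy is continuous, so the integrals can be combined
  let D : IncrPath d → ℝ → ℝ → ℝ := fun y t s ↦ W (incr s t y) (t - s)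
  have hD : ∀ y, Continuous (Function.uncurry (D y)) := continuous_pathEnergy_integrand hW
  have hD1 : ∀ y t, Continuous (D y t) := fun y t ↦ (hD y).comp (Continuous.prodMk_right t)
  have cont : ∀ (f : ℝ → ℝ → ℝ), Continuous (Function.uncurry f) →
      Continuous fun t ↦ ∫ s in -T..T, f t s := fun f hf ↦
    intervalIntegral.continuous_parametric_intervalIntegral_of_continuous' hf _ _
  set y := shiftPath a b v r x
  set z := shiftPath a b v (-r) x
  have hsum : pathEnergy W (-T) T y + pathEnergy W (-T) T z - 2 * pathEnergy W (-T) T x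
      = ∫ t in -T..T, ∫ s in -T..T, (D y t s + D z t s - 2 * D x t s) := by
    have h1 : ∀ t, ∫ s in -T..T, (D y t s + D z t s - 2 * D x t s)
        = (∫ s in -T..T, D y t s) + (∫ s in -T..T, D z t s) - 2 * ∫ s in -T..T, D x t s := by
      intro t
      have := hD1 x t
      have := hD1 y t
      have := hD1 z t
      rw [intervalIntegral.integral_sub, intervalIntegral.integral_add,
        intervalIntegral.integral_const_mul] <;>
        exact Continuous.intervalIntegrable (by fun_prop) _ _
    simp_rw [h1]
    have := cont _ (hD x)
    have := cont _ (hD y)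
    have := cont _ (hD z)
    rw [intervalIntegral.integral_sub, intervalIntegral.integral_add,
        intervalIntegral.integral_const_mul]
    · rfl
    all_goals exact Continuous.intervalIntegrable (by fun_prop) _ _
  have hpt : ∀ t s, |D y t s + D z t s - 2 * D x t s|
      ≤ r ^ 2 * (2 * (K / (1 + |t - s|) ^ α) * (ramp a b t - ramp a b s) ^ 2) := by
    intro t s
    have := abs_second_difference_le (hC (t - s)) (hK (t - s)) (incr s t x)
      ((r * (ramp a b t - ramp a b s)) • v)
    simp only [D, y, z, incr_shiftPath, neg_mul, neg_smul, ← sub_eq_add_neg]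
    refine this.trans (le_of_eq ?_)
    rw [norm_smul, hv, mul_one, Real.norm_eq_abs, sq_abs]
    ring
  rw [hsum]
  have hDc : Continuous (Function.uncurry fun t s ↦ D y t s + D z t s - 2 * D x t s) := by
    have := hD x
    have := hD y
    have := hD z
    simp only [Function.uncurry_def] at *
    fun_prop
  have hRc : Continuous (Function.uncurry fun t s ↦
      r ^ 2 * (2 * (K / (1 + |t - s|) ^ α) * (ramp a b t - ramp a b s) ^ 2)) := by
    have := hg.comp (by fun_prop : Continuous fun p : ℝ × ℝ ↦ p.1 - p.2)
    simp only [Function.uncurry_def, Function.comp_def] at *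
    fun_prop
  calc |∫ t in -T..T, ∫ s in -T..T, (D y t s + D z t s - 2 * D x t s)|
      ≤ ∫ t in -T..T, |∫ s in -T..T, (D y t s + D z t s - 2 * D x t s)| :=
        intervalIntegral.abs_integral_le_integral_abs hTT
    _ ≤ ∫ t in -T..T, ∫ s in -T..T,
          r ^ 2 * (2 * (K / (1 + |t - s|) ^ α) * (ramp a b t - ramp a b s) ^ 2) := by
        refine intervalIntegral.integral_mono_on hTT
          ((cont _ hDc).abs.intervalIntegrable _ _) ((cont _ hRc).intervalIntegrable _ _)
          fun t _ ↦ (intervalIntegral.abs_integral_le_integral_abs hTT).trans ?_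
        refine intervalIntegral.integral_mono_on hTT
          ((hDc.comp (Continuous.prodMk_right t)).abs.intervalIntegrable _ _)
          ((hRc.comp (Continuous.prodMk_right t)).intervalIntegrable _ _) fun s _ ↦ hpt t s
    _ = r ^ 2 * ∫ t in -T..T, ∫ s in -T..T,
          2 * (K / (1 + |t - s|) ^ α) * (ramp a b t - ramp a b s) ^ 2 := by
        simp only [intervalIntegral.integral_const_mul]
    _ ≤ _ := by
        gcongr
        exact integral_integral_mul_ramp_sub_sq_le hab hT hg hK0
          (integrable_mul_one_add_abs_rpow_mul_sq K hα)

/-! ### Gaussian structure and the Cameron-Martin formula -/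

/-- The one-dimensional Cameron-Martin formula. -/
theorem lintegral_gaussianReal_comp_add {κ : NNReal} (hκ : κ ≠ 0) (r : ℝ) {k : ℝ → ENNReal}
    (hk : Measurable k) :
    ∫⁻ f, k (f + r * κ) ∂gaussianReal 0 κ
      = ∫⁻ f, k f * ENNReal.ofReal (Real.exp (r * f - r ^ 2 * κ / 2)) ∂gaussianReal 0 κ := by
  have hκ' : (κ : ℝ) ≠ 0 := NNReal.coe_ne_zero.2 hκ
  have hk' : Measurable fun f ↦ k (f + r * κ) := hk.comp (by fun_prop)
  have hk'' : Measurable fun f ↦ k f * ENNReal.ofReal (Real.exp (r * f - r ^ 2 * κ / 2)) :=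
    hk.mul (by fun_prop)
  rw [gaussianReal_of_var_ne_zero _ hκ,
    lintegral_withDensity_eq_lintegral_mul _ (measurable_gaussianPDF _ _) hk',
    lintegral_withDensity_eq_lintegral_mul _ (measurable_gaussianPDF _ _) hk'',
    ← lintegral_sub_right_eq_self _ (r * κ : ℝ)]
  congr 1 with f
  simp only [Pi.mul_apply, sub_add_cancel, gaussianPDF]
  rw [mul_left_comm, mul_comm, ← ENNReal.ofReal_mul (gaussianPDFReal_nonneg _ _ _)]
  congr 2
  simp only [gaussianPDFReal, mul_assoc, ← Real.exp_add]
  congr 2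
  field_simp
  ring

namespace IsWienerIncrementMeasure

variable {μ : Measure (IncrPath d)} (hμ : IsWienerIncrementMeasure μ)
include hμ

theorem hasLaw_inner_incr (s t : ℝ) (v : EuclideanSpace ℝ (Fin d)) :
    HasLaw (fun x ↦ inner ℝ v (incr s t x)) (gaussianReal 0 (‖v‖₊ ^ 2 * ‖t - s‖₊)) μ :=
  ⟨by fun_prop, hμ.gaussian s t v⟩

theorem isProbabilityMeasure : IsProbabilityMeasure μ :=
  (hμ.hasLaw_inner_incr 0 0 0).hasGaussianLaw.isProbabilityMeasure

theorem hasGaussianLaw_incr (s t : ℝ) : HasGaussianLaw (incr s t) μ where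
  isGaussian_map := ⟨fun L ↦ by
    obtain ⟨v, rfl⟩ := (InnerProductSpace.toDual ℝ (EuclideanSpace ℝ (Fin d))).surjective L
    have h := hμ.hasLaw_inner_incr s t v
    have hm := measurable_incr (d := d) s t
    rw [Measure.map_map (by fun_prop) hm, integral_map hm.aemeasurable (by fun_prop),
      variance_map (by fun_prop) hm.aemeasurable]
    have h1 : (⇑((InnerProductSpace.toDual ℝ (EuclideanSpace ℝ (Fin d))) v) ∘ incr s t)
      = fun x : IncrPath d ↦ inner ℝ v (incr s t x) := rfl
    have h2 : ∫ x, ((InnerProductSpace.toDual ℝ (EuclideanSpace ℝ (Fin d))) v) (incr s t x) ∂μ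
      = 0 := by
      refine Eq.trans (h.integral_eq) ?_
      simp
    rw [h1, h2, h.map_eq, h.variance_eq, variance_id_gaussianReal,
      Real.toNNReal_coe]⟩

theorem variance_inner_incr (s t : ℝ) (v : EuclideanSpace ℝ (Fin d)) :
    Var[fun x ↦ inner ℝ v (incr s t x); μ] = ‖v‖ ^ 2 * |t - s| := by
  rw [(hμ.hasLaw_inner_incr s t v).variance_eq, variance_id_gaussianReal]; simp

theorem memLp_two_inner_incr (s t : ℝ) (v : EuclideanSpace ℝ (Fin d)) :
    MemLp (fun x ↦ inner ℝ v (incr s t x)) 2 μ :=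
  ((hμ.hasGaussianLaw_incr s t).map (innerSL ℝ v)).memLp_two

theorem covariance_inner_incr_self (s t : ℝ) (v w : EuclideanSpace ℝ (Fin d)) :
    cov[fun x ↦ inner ℝ v (incr s t x), fun x ↦ inner ℝ w (incr s t x); μ]
      = inner ℝ v w * |t - s| := by
  have := hμ.isProbabilityMeasure
  have h := variance_add (hμ.memLp_two_inner_incr s t v) (hμ.memLp_two_inner_incr s t w)
  have h1 : ((fun x ↦ inner ℝ v (incr s t x)) + fun x ↦ inner ℝ w (incr s t x))
    = fun x : IncrPath d ↦ inner ℝ (v + w) (incr s t x) := by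
    ext x; simp [inner_add_left]
  rw [h1, hμ.variance_inner_incr, hμ.variance_inner_incr, hμ.variance_inner_incr,
    norm_add_sq_real] at h
  linarith

theorem covariance_inner_incr_of_le {s t u : ℝ} (hst : s ≤ t) (htu : t ≤ u)
    (v w : EuclideanSpace ℝ (Fin d)) :
    cov[fun x ↦ inner ℝ v (incr s t x), fun x ↦ inner ℝ w (incr t u x); μ] = 0 := by
  have hmono : Monotone ![s, t, u] := by
    intro i j hij
    fin_cases i <;> fin_cases j <;> simp at hij ⊢ <;> linarith
  have h := (hμ.indep 2 ![s, t, u] hmono).indepFun (i := 0) (j := 1) (by simp)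
  have h' : IndepFun (incr (d := d) s t) (incr t u) μ := h
  exact (h'.comp (φ := fun y ↦ inner ℝ v y) (ψ := fun y ↦ inner ℝ w y)
    (by fun_prop) (by fun_prop)).covariance_eq_zero (hμ.memLp_two_inner_incr s t v)
    (hμ.memLp_two_inner_incr t u w)

/-- The ramp is the covariance of the Brownian path with its increment over `[a, b]`; hence the
increment is the Wiener integral in the Cameron-Martin density for the ramp. -/
theorem covariance_inner_incr_ramp {a b : ℝ} (hab : a ≤ b) (t : ℝ)
    (v w : EuclideanSpace ℝ (Fin d)) :
    cov[fun x ↦ inner ℝ w (incr a t x), fun x ↦ inner ℝ v (incr a b x); μ]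
      = inner ℝ w v * (ramp a b t - ramp a b a) := by
  have := hμ.isProbabilityMeasure
  have hra : ramp a b a = a := by simp [ramp, hab]
  rw [hra]
  have hsplit : ∀ (u : EuclideanSpace ℝ (Fin d)) (p q r : ℝ),
      (fun x : IncrPath d ↦ inner ℝ u (incr p r x))
        = (fun x ↦ inner ℝ u (incr p q x)) + fun x ↦ inner ℝ u (incr q r x) := fun u p q r ↦ by
    ext x; simp [← incr_add_incr p q r x, inner_add_right]
  rcases le_total t a with hta | hat
  · have h1 : (fun x : IncrPath d ↦ inner ℝ w (incr a t x)) = -fun x ↦ inner ℝ w (incr t a x) := by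
      ext x; simp [incr_symm t a x]
    rw [h1, covariance_neg_left, hμ.covariance_inner_incr_of_le hta hab]
    simp [ramp, hta]
  rcases le_total t b with htb | hbt
  · rw [hsplit v a t b, covariance_add_right (hμ.memLp_two_inner_incr _ _ _)
      (hμ.memLp_two_inner_incr _ _ _) (hμ.memLp_two_inner_incr _ _ _),
      hμ.covariance_inner_incr_of_le hat htb, hμ.covariance_inner_incr_self,
      abs_of_nonneg (sub_nonneg.2 hat)]
    simp [ramp, hat, htb]
  · rw [hsplit w a b t, covariance_add_left (hμ.memLp_two_inner_incr _ _ _)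
      (hμ.memLp_two_inner_incr _ _ _) (hμ.memLp_two_inner_incr _ _ _),
      covariance_comm (fun x ↦ inner ℝ w (incr b t x)),
      hμ.covariance_inner_incr_of_le hab hbt, hμ.covariance_inner_incr_self,
      abs_of_nonneg (sub_nonneg.2 hab)]
    simp [ramp, hab, hbt]

theorem isGaussianProcess_incr (a : ℝ) : IsGaussianProcess (incr (d := d) a) μ where
  hasGaussianLaw I := by
    classical
    -- a base point `c` to the left of all times, so that the process starts at its least time
    obtain ⟨c, hc⟩ := (insert a I).bddBelow
    have hca : c ≤ a := hc (by simp)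
    have hcI : ∀ t ∈ I, c ≤ t := fun t ht ↦ hc (by simp [ht])
    have h : IsGaussianProcess (fun t : Set.Ici c ↦ incr (d := d) c t) μ := by
      refine HasIndepIncrements.isGaussianProcess (fun t ↦ hμ.hasGaussianLaw_incr c t)
        (Filter.Eventually.of_forall fun x ↦ incr_self c x) fun n t ht ↦ ?_
      convert hμ.indep n (fun i ↦ (t i : ℝ)) (fun i j hij ↦ ht hij) using 3 with i x
      rw [← incr_add_incr c (t i.castSucc) (t i.succ), add_sub_cancel_left]
    let J : Finset (Set.Ici c) := insert ⟨a, hca⟩ (I.subtype (· ∈ Set.Ici c))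
    let L : (J → EuclideanSpace ℝ (Fin d)) →L[ℝ] (I → EuclideanSpace ℝ (Fin d)) :=
      { toFun y i := y ⟨⟨i, hcI i i.2⟩, by simp [J]⟩ - y ⟨⟨a, hca⟩, by simp [J]⟩
        map_add' y z := by ext; simp; ring
        map_smul' m y := by ext; simp; ring }
    have hL : (fun x ↦ I.restrict fun t ↦ incr (d := d) a t x)
        = L ∘ fun x ↦ J.restrict fun t : Set.Ici c ↦ incr (d := d) c t x := by
      ext x i : 2
      simp [L, ← incr_add_incr c a i x]
    rw [hL]
    exact (h.hasGaussianLaw J).map L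

/-- Subtracting from the path its conditional expectation given `⟨v, X_ab⟩` leaves a path that is
independent of `⟨v, X_ab⟩`. -/
theorem indepFun_shiftPath {a b : ℝ} (hab : a < b) {v : EuclideanSpace ℝ (Fin d)}
    (hv : ‖v‖ = 1) :
    IndepFun (fun x ↦ shiftPath a b v (-(inner ℝ v (incr a b x) / (b - a))) x)
      (fun x ↦ inner ℝ v (incr a b x)) μ := by
  classical
  have := hμ.isProbabilityMeasure
  have hba : b - a ≠ 0 := (sub_pos.2 hab).ne'
  let E := EuclideanSpace ℝ (Fin d)
  let F : IncrPath d → ℝ := fun x ↦ inner ℝ v (incr a b x)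
  let Y : ℝ → IncrPath d → E := fun t x ↦ incr a t (shiftPath a b v (-(F x / (b - a))) x)
  -- the scalar increment is embedded into `E`, since jointly Gaussian processes share a state space
  let Z : Unit → IncrPath d → E := fun _ x ↦ F x • v
  have hFm : Measurable F := by fun_prop
  have hY : ∀ t, Measurable (Y t) := fun t ↦ by
    simp only [Y, incr_shiftPath]; fun_prop
  have hZ : ∀ t, Measurable (Z t) := fun t ↦ by fun_prop
  have hproc : IsGaussianProcess (Sum.elim Y Z) μ := by
    refine IsGaussianProcess.of_isGaussianProcess (hμ.isGaussianProcess_incr a) fun s ↦ ?_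
    rcases s with t | _
    · let c := (ramp a b t - ramp a b a) / (b - a)
      let L : (({t, b} : Finset ℝ) → E) →L[ℝ] E :=
        { toFun y := y ⟨t, by simp⟩ - (c * inner ℝ v (y ⟨b, by simp⟩)) • v
          map_add' y z := by simp only [Pi.add_apply, inner_add_right]; module
          map_smul' m y := by
            simp only [Pi.smul_apply, inner_smul_right, RingHom.id_apply]; module
          cont := by fun_prop }
      refine ⟨{t, b}, L, fun x ↦ ?_⟩
      change incr a t x + _ • v = incr a t x - (c * F x) • v
      have : -(F x / (b - a)) * (ramp a b t - ramp a b a) = -(c * F x) := by ring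
      rw [this, neg_smul, sub_eq_add_neg]
    · exact ⟨{b}, (innerSL ℝ v).smulRight v ∘L .proj ⟨b, by simp⟩, fun x ↦ by simp [Z, F]⟩
  have hind := hproc.indepFun_of_covariance_inner (fun t ↦ (hY t).aemeasurable)
    (fun t ↦ (hZ t).aemeasurable) fun t _ w w' ↦ by
      have h1 : (fun x ↦ inner ℝ w (Y t x)) = (fun x ↦ inner ℝ w (incr a t x)) -
          fun x ↦ (inner ℝ w v * (ramp a b t - ramp a b a) / (b - a)) * F x := by
        ext x; simp [Y, incr_shiftPath, inner_add_right, inner_smul_right]; ring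
      have h2 : (fun x ↦ inner ℝ w' (Z () x)) = fun x ↦ inner ℝ w' v * F x := by
        ext x; simp [Z, inner_smul_right]; ring
      have hFL : MemLp F 2 μ := hμ.memLp_two_inner_incr a b v
      rw [h1, h2, covariance_const_mul_right, covariance_sub_left (hμ.memLp_two_inner_incr _ _ _)
        (hFL.const_mul _) hFL, covariance_const_mul_left,
        hμ.covariance_inner_incr_ramp hab.le, covariance_self hFm.aemeasurable,
        hμ.variance_inner_incr, hv, abs_of_pos (sub_pos.2 hab)]
      field_simp
      ring
  have h3 := hind.comp (φ := fun y s t ↦ y t - y s) (ψ := fun z ↦ inner ℝ v (z ()))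
    (measurable_pi_lambda _ fun s ↦ measurable_pi_lambda _ fun t ↦
      (measurable_pi_apply t).sub (measurable_pi_apply s)) (by fun_prop)
  have h4 : (fun z : Unit → E ↦ inner ℝ v (z ())) ∘ (fun x t ↦ Z t x) = F := by
    ext x; simp [Z, inner_smul_right, hv]
  have h5 : (fun (y : ℝ → E) s t ↦ y t - y s) ∘ (fun x t ↦ Y t x)
      = fun x ↦ (shiftPath a b v (-(F x / (b - a))) x).1 := by
    ext x s t : 3
    change incr a t _ - incr a s _ = incr s t _
    rw [← incr_add_incr a s t, add_sub_cancel_left]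
  rw [h4, h5] at h3
  -- the σ-algebra of paths is induced by the inclusion into all functions
  rw [IndepFun_iff_Indep] at h3 ⊢
  refine Eq.mp ?_ h3
  congr 1
  exact (MeasurableSpace.comap_comp (g := fun x ↦ shiftPath a b v (-(F x / (b - a))) x)
    (f := Subtype.val)).symm

/-- **Cameron-Martin formula** for translation along a ramp. -/
theorem lintegral_comp_shiftPath {a b : ℝ} (hab : a < b) {v : EuclideanSpace ℝ (Fin d)}
    (hv : ‖v‖ = 1) (r : ℝ) {g : IncrPath d → ENNReal} (hg : Measurable g) :
    ∫⁻ x, g (shiftPath a b v r x) ∂μ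
      = ∫⁻ x, g x * ENNReal.ofReal
          (Real.exp (r * inner ℝ v (incr a b x) - r ^ 2 * (b - a) / 2)) ∂μ := by
  have := hμ.isProbabilityMeasure
  have hba : 0 < b - a := sub_pos.2 hab
  let F : IncrPath d → ℝ := fun x ↦ inner ℝ v (incr a b x)
  have hF : Measurable F := by fun_prop
  let Y : IncrPath d → IncrPath d := fun x ↦ shiftPath a b v (-(F x / (b - a))) x
  have hY : Measurable Y := (measurable_shiftPath a b v).comp
    (by fun_prop : Measurable fun x ↦ (x, -(F x / (b - a))))
  let κ : NNReal := ⟨b - a, hba.le⟩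
  have hκba : (κ : ℝ) = b - a := rfl
  have hlaw : μ.map F = gaussianReal 0 κ := by
    rw [hμ.gaussian a b v]
    congr 1
    ext
    rw [hκba]
    push_cast
    rw [hv, Real.norm_eq_abs, abs_of_pos hba, one_pow, one_mul]
  have hprod : μ.map (fun x ↦ (Y x, F x)) = (μ.map Y).prod (gaussianReal 0 κ) := by
    rw [← hlaw]
    exact (indepFun_iff_map_prod_eq_prod_map_map hY.aemeasurable hF.aemeasurable).1
      (hμ.indepFun_shiftPath hab hv)
  have hrec : ∀ q x, shiftPath a b v (q + F x / (b - a)) (Y x) = shiftPath a b v q x := fun q x ↦ by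
    simp [Y, shiftPath_shiftPath]
  have hdisint : ∀ Φ : IncrPath d → ℝ → ENNReal, Measurable (Function.uncurry Φ) →
      ∫⁻ x, Φ (Y x) (F x) ∂μ = ∫⁻ y, ∫⁻ f, Φ y f ∂gaussianReal 0 κ ∂μ.map Y := fun Φ hΦ ↦ by
    have h := lintegral_prod (μ := μ.map Y) (ν := gaussianReal 0 κ) _ hΦ.aemeasurable
    rw [← hprod, lintegral_map hΦ (hY.prodMk hF)] at h
    exact h
  have hgs : ∀ q : ℝ, Measurable fun p : IncrPath d × ℝ ↦
      g (shiftPath a b v (q + p.2 / (b - a)) p.1) :=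
    fun q ↦ hg.comp ((measurable_shiftPath a b v).comp
      (by fun_prop : Measurable fun p : IncrPath d × ℝ ↦ (p.1, q + p.2 / (b - a))))
  -- disintegrate into the bridge `Y` and the independent increment `F`, translate `F` on the real
  -- line, and reassemble the path
  calc ∫⁻ x, g (shiftPath a b v r x) ∂μ
      = ∫⁻ x, g (shiftPath a b v (r + F x / (b - a)) (Y x)) ∂μ := by simp only [hrec]
    _ = ∫⁻ y, ∫⁻ f, g (shiftPath a b v (r + f / (b - a)) y) ∂gaussianReal 0 κ ∂μ.map Y :=
        hdisint (fun y f ↦ g (shiftPath a b v (r + f / (b - a)) y)) (hgs r)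
    _ = ∫⁻ y, ∫⁻ f, g (shiftPath a b v (0 + f / (b - a)) y) * ENNReal.ofReal
          (Real.exp (r * f - r ^ 2 * (b - a) / 2)) ∂gaussianReal 0 κ ∂μ.map Y := by
        congr 1 with y
        have hκ : κ ≠ 0 := fun h ↦ hba.ne' (congrArg NNReal.toReal h)
        have h := lintegral_gaussianReal_comp_add hκ r
          (k := fun f ↦ g (shiftPath a b v (0 + f / (b - a)) y))
          ((hgs 0).comp measurable_prodMk_left)
        rw [hκba] at h
        rw [← h]
        congr 1 with f
        congr 2
        field_simp
        ring
    _ = ∫⁻ x, g (shiftPath a b v (0 + F x / (b - a)) (Y x)) * ENNReal.ofReal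
          (Real.exp (r * F x - r ^ 2 * (b - a) / 2)) ∂μ :=
        (hdisint (fun y f ↦ g (shiftPath a b v (0 + f / (b - a)) y) * ENNReal.ofReal
          (Real.exp (r * f - r ^ 2 * (b - a) / 2)))
          ((hgs 0).mul (by fun_prop))).symm
    _ = _ := by
        simp only [hrec]
        congr 1 with x
        congr 2
        exact incr_ext fun s t ↦ by simp [incr_shiftPath]

end IsWienerIncrementMeasure

/-! ### From exponential moments to the second moment -/

theorem Real.cosh_le_one_add_sq_add (u : ℝ) :
    Real.cosh u ≤ 1 + u ^ 2 / 2 + |u| ^ 3 * Real.exp |u| := by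
  have h : ∀ u : ℝ, Real.exp u ≤ 1 + u + u ^ 2 / 2 + |u| ^ 3 * Real.exp |u| := fun u ↦ by
    have h := Complex.norm_exp_sub_sum_le_norm_mul_exp u 3
    have e : Complex.exp u - ∑ m ∈ Finset.range 3, (u : ℂ) ^ m / m.factorial
        = ((Real.exp u - (1 + u + u ^ 2 / 2) : ℝ) : ℂ) := by
      simp [Finset.sum_range_succ]
    rw [e, Complex.norm_real, Complex.norm_real, Real.norm_eq_abs, Real.norm_eq_abs] at h
    linarith [le_abs_self (Real.exp u - (1 + u + u ^ 2 / 2))]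
  have h1 := h u
  have h2 := h (-u)
  rw [abs_neg] at h2
  rw [Real.cosh_eq]
  linarith

/-- A quadratic lower bound on the symmetrized exponential moments near `0` is a lower bound on the
second moment. -/
theorem two_mul_le_integral_sq_of_le_integral_cosh {Ω : Type*} [MeasurableSpace Ω] {ν : Measure Ω}
    [IsProbabilityMeasure ν] {X : Ω → ℝ}
    (hX : ∀ t : ℝ, Integrable (fun ω ↦ Real.exp (t * X ω)) ν) {q : ℝ}
    (h : ∀ r : ℝ, 1 + r ^ 2 * q ≤ ∫ ω, Real.cosh (r * X ω) ∂ν) :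
    2 * q ≤ ∫ ω, X ω ^ 2 ∂ν := by
  have h2 : Integrable (fun ω ↦ X ω ^ 2) ν :=
    integrable_pow_of_integrable_exp_mul one_ne_zero (hX 1) (hX (-1)) 2
  have h3 : Integrable (fun ω ↦ |X ω| ^ 3 * Real.exp |X ω|) ν := by
    have e1 : Integrable (fun ω ↦ |X ω| ^ 3 * Real.exp (1 * X ω)) ν :=
      integrable_pow_abs_mul_exp_of_integrable_exp_mul one_ne_zero (hX _) (hX _) 3
    have e2 : Integrable (fun ω ↦ |X ω| ^ 3 * Real.exp (-1 * X ω)) ν :=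
      integrable_pow_abs_mul_exp_of_integrable_exp_mul one_ne_zero (hX _) (hX _) 3
    have hm : AEMeasurable X ν :=
      aemeasurable_of_integrable_exp_mul (u := 0) (v := 1) (by simp) (hX 0) (hX 1)
    refine (e1.add e2).mono' (AEMeasurable.aestronglyMeasurable (by fun_prop))
      (Filter.Eventually.of_forall fun ω ↦ ?_)
    rw [Real.norm_of_nonneg (by positivity), Pi.add_apply, ← mul_add]
    gcongr
    rcases abs_choice (X ω) with h | h <;> rw [h]
    · simpa using (Real.exp_pos _).le
    · simpa using (Real.exp_pos _).le
  set R := ∫ ω, |X ω| ^ 3 * Real.exp |X ω| ∂ν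
  have key : ∀ r : ℝ, 0 < r → r ≤ 1 → q ≤ (∫ ω, X ω ^ 2 ∂ν) / 2 + r * R := by
    intro r hr hr1
    have hle : ∫ ω, Real.cosh (r * X ω) ∂ν
        ≤ ∫ ω, (1 + r ^ 2 / 2 * X ω ^ 2 + r ^ 3 * (|X ω| ^ 3 * Real.exp |X ω|)) ∂ν := by
      refine integral_mono ?_ (((integrable_const _).add (h2.const_mul _)).add (h3.const_mul _))
        fun ω ↦ (Real.cosh_le_one_add_sq_add _).trans ?_
      · have := ((hX r).add (hX (-r))).div_const 2
        refine this.congr (Filter.Eventually.of_forall fun ω ↦ ?_)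
        simp [Real.cosh_eq]
      · have : |r * X ω| ≤ |X ω| := by
          rw [abs_mul, abs_of_pos hr]
          exact mul_le_of_le_one_left (abs_nonneg _) hr1
        have e : |r * X ω| ^ 3 = r ^ 3 * |X ω| ^ 3 := by rw [abs_mul, abs_of_pos hr, mul_pow]
        rw [e, mul_assoc, mul_pow]
        have : Real.exp |r * X ω| ≤ Real.exp |X ω| := Real.exp_le_exp.2 this
        have := mul_le_mul_of_nonneg_left this (by positivity : 0 ≤ r ^ 3 * |X ω| ^ 3)
        linarith
    have hc : Integrable (fun ω ↦ 1 + r ^ 2 / 2 * X ω ^ 2) ν :=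
      (integrable_const 1).add (h2.const_mul _)
    rw [integral_add hc (h3.const_mul _), integral_add (integrable_const 1) (h2.const_mul _),
      integral_const_mul, integral_const_mul, integral_const, probReal_univ, one_smul] at hle
    have := (h r).trans hle
    have : r ^ 2 * q ≤ r ^ 2 * ((∫ ω, X ω ^ 2 ∂ν) / 2 + r * R) := by linarith
    exact le_of_mul_le_mul_left this (by positivity)
  have hlim : Filter.Tendsto (fun r : ℝ ↦ (∫ ω, X ω ^ 2 ∂ν) / 2 + r * R)
      (nhdsWithin 0 (Set.Ioi 0))
      (nhds ((∫ ω, X ω ^ 2 ∂ν) / 2 + 0 * R)) :=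
    (Continuous.tendsto (by fun_prop) 0).mono_left nhdsWithin_le_nhds
  have := ge_of_tendsto hlim (by
    filter_upwards [Ioc_mem_nhdsGT (zero_lt_one (α := ℝ))] with r hr using key r hr.1 hr.2)
  linarith

/-! ### The tilted measure -/

theorem inner_incr_shiftPath {a b : ℝ} (hab : a ≤ b) {v : EuclideanSpace ℝ (Fin d)} (hv : ‖v‖ = 1)
    (r : ℝ) (x : IncrPath d) :
    inner ℝ v (incr a b (shiftPath a b v r x)) = inner ℝ v (incr a b x) + r * (b - a) := by
  simp [incr_shiftPath, inner_add_right, inner_smul_right, hv, ramp, hab]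

/-- If the second difference of `H` in the direction of the ramp is at most `r² A (b - a)`, then
under the density `exp (-lam H)` the expectation of `cosh (δ ⟨v, X_ab⟩)` is at least that for a
centred Gaussian of variance `(b - a) / (1 + |lam| A)` in place of `⟨v, X_ab⟩`. -/
theorem IsWienerIncrementMeasure.exp_mul_lintegral_le {μ : Measure (IncrPath d)}
    (hμ : IsWienerIncrementMeasure μ) {H : IncrPath d → ℝ} (hH : Measurable H) {a b : ℝ}
    (hab : a < b) {v : EuclideanSpace ℝ (Fin d)} (hv : ‖v‖ = 1) {A : ℝ} (hA : 0 ≤ A)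
    (hHA : ∀ r x, |H (shiftPath a b v r x) + H (shiftPath a b v (-r) x) - 2 * H x|
      ≤ r ^ 2 * (A * (b - a))) (lam δ : ℝ) :
    ENNReal.ofReal (Real.exp (δ ^ 2 * ((b - a) / (2 * (1 + |lam| * A)))))
        * ∫⁻ x, ENNReal.ofReal (Real.exp (-lam * H x)) ∂μ
      ≤ ∫⁻ x, ENNReal.ofReal
          (Real.exp (-lam * H x) * Real.cosh (δ * inner ℝ v (incr a b x))) ∂μ := by
  set M := 1 + |lam| * A
  have hM : 0 < M := by positivity
  set F : IncrPath d → ℝ := fun x ↦ inner ℝ v (incr a b x)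
  have hF : Measurable F := by fun_prop
  -- `r` maximizes the exponent; `k` makes the weights after translation equal to `exp (± δ F)`
  set r := δ / M with hr
  set k := r - δ
  set e := k * r * (b - a) - r ^ 2 * (b - a) / 2
  set c := |lam| * A * (b - a) / 2
  have hshift : ∀ q x, F (shiftPath a b v q x) = F x + q * (b - a) := fun q x ↦
    inner_incr_shiftPath hab.le hv q x
  let g₁ : IncrPath d → ℝ := fun x ↦ Real.exp (-lam * H x - k * (F x - r * (b - a))) / 2
  let g₂ : IncrPath d → ℝ := fun x ↦ Real.exp (-lam * H x + k * (F x + r * (b - a))) / 2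
  have hg₁ : Measurable fun x ↦ ENNReal.ofReal (g₁ x) := by fun_prop
  have hg₂ : Measurable fun x ↦ ENNReal.ofReal (g₂ x) := by fun_prop
  have hs : ∀ q, Measurable (shiftPath a b v q) := fun q ↦
    (measurable_shiftPath a b v).comp (by fun_prop : Measurable fun x ↦ (x, q))
  -- the inequality between arithmetic and geometric mean, and the second difference bound
  have hpt : ∀ x, Real.exp (-c * r ^ 2) * Real.exp (-lam * H x)
      ≤ g₁ (shiftPath a b v r x) + g₂ (shiftPath a b v (-r) x) := by
    intro x
    simp only [g₁, g₂, hshift]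
    set a₁ := -lam * H (shiftPath a b v r x) - k * (F x + r * (b - a) - r * (b - a)) with ha₁
    set a₂ := -lam * H (shiftPath a b v (-r) x) + k * (F x + -r * (b - a) + r * (b - a)) with ha₂
    have h1 : Real.exp ((a₁ + a₂) / 2) ≤ Real.exp a₁ / 2 + Real.exp a₂ / 2 := by
      have e1 : Real.exp a₁ = Real.exp (a₁ / 2) ^ 2 := by rw [← Real.exp_nat_mul]; congr 1; ring
      have e2 : Real.exp a₂ = Real.exp (a₂ / 2) ^ 2 := by rw [← Real.exp_nat_mul]; congr 1; ring
      rw [add_div, Real.exp_add, e1, e2]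
      linarith [two_mul_le_add_sq (Real.exp (a₁ / 2)) (Real.exp (a₂ / 2))]
    refine le_trans ?_ h1
    rw [← Real.exp_add, Real.exp_le_exp]
    have h2 : lam * (H (shiftPath a b v r x) + H (shiftPath a b v (-r) x) - 2 * H x)
        ≤ |lam| * (r ^ 2 * (A * (b - a))) := by
      refine (le_abs_self _).trans ?_
      rw [abs_mul]
      exact mul_le_mul_of_nonneg_left (hHA r x) (abs_nonneg _)
    have h3 : c * r ^ 2 = |lam| * (r ^ 2 * (A * (b - a))) / 2 := by simp only [c]; ring
    rw [ha₁, ha₂]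
    linarith
  have hexp : e + δ ^ 2 * ((b - a) / (2 * M)) = -c * r ^ 2 := by
    have hδ : δ = M * r := by rw [hr]; field_simp
    have : |lam| * A = M - 1 := by simp [M]
    simp only [e, c, k, this, hδ]
    field_simp
    ring
  have hint : ENNReal.ofReal (Real.exp (-c * r ^ 2))
        * ∫⁻ x, ENNReal.ofReal (Real.exp (-lam * H x)) ∂μ
      ≤ ENNReal.ofReal (Real.exp e) * ∫⁻ x, ENNReal.ofReal
          (Real.exp (-lam * H x) * Real.cosh (δ * F x)) ∂μ := by
    rw [← lintegral_const_mul _ (by fun_prop), ← lintegral_const_mul _ (by fun_prop)]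
    calc ∫⁻ x, ENNReal.ofReal (Real.exp (-c * r ^ 2)) * ENNReal.ofReal (Real.exp (-lam * H x)) ∂μ
        ≤ ∫⁻ x, (ENNReal.ofReal (g₁ (shiftPath a b v r x))
            + ENNReal.ofReal (g₂ (shiftPath a b v (-r) x))) ∂μ := by
          refine lintegral_mono fun x ↦ ?_
          rw [← ENNReal.ofReal_mul (Real.exp_pos _).le,
            ← ENNReal.ofReal_add (by positivity) (by positivity)]
          exact ENNReal.ofReal_le_ofReal (hpt x)
      _ = ∫⁻ x, (ENNReal.ofReal (g₁ x) * ENNReal.ofReal (Real.exp (r * F x - r ^ 2 * (b - a) / 2))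
            + ENNReal.ofReal (g₂ x)
              * ENNReal.ofReal (Real.exp (-r * F x - (-r) ^ 2 * (b - a) / 2))) ∂μ := by
          have h₁ : Measurable fun x ↦ ENNReal.ofReal (g₁ (shiftPath a b v r x)) := hg₁.comp (hs r)
          have h₂ : Measurable fun x ↦ ENNReal.ofReal (g₁ x)
              * ENNReal.ofReal (Real.exp (r * F x - r ^ 2 * (b - a) / 2)) := hg₁.mul (by fun_prop)
          rw [lintegral_add_left h₁, lintegral_add_left h₂,
            hμ.lintegral_comp_shiftPath hab hv r hg₁, hμ.lintegral_comp_shiftPath hab hv (-r) hg₂]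
      _ = _ := by
          congr 1 with x
          rw [← ENNReal.ofReal_mul (by positivity), ← ENNReal.ofReal_mul (by positivity),
            ← ENNReal.ofReal_mul (by positivity),
            ← ENNReal.ofReal_add (by positivity) (by positivity)]
          congr 1
          simp only [g₁, g₂, Real.cosh_eq, div_mul_eq_mul_div, ← Real.exp_add, mul_div_assoc',
            mul_add, ← add_div]
          congr 3 <;> simp only [e, k] <;> ring
  rw [← hexp, Real.exp_add, ENNReal.ofReal_mul (Real.exp_pos _).le, mul_assoc] at hint
  exact (ENNReal.mul_le_mul_iff_right (by simp [Real.exp_pos]) ENNReal.ofReal_ne_top).1 hint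

theorem exists_exp_neg_mul_pathEnergy_le {W : EuclideanSpace ℝ (Fin d) → ℝ → ℝ}
    (hH1 : EnergyBounded W) (lam : ℝ) {T : ℝ} (hT : 0 < T) :
    ∃ m : ℝ, ∀ x, ‖Real.exp (-lam * pathEnergy W (-T) T x)‖ ≤ m := by
  obtain ⟨C, hC⟩ := hH1
  refine ⟨Real.exp (|lam| * (C * (T - -T) ^ 2)), fun x ↦ ?_⟩
  rw [Real.norm_eq_abs, Real.abs_exp, Real.exp_le_exp]
  refine (le_abs_self _).trans ?_
  rw [abs_mul, abs_neg]
  exact mul_le_mul_of_nonneg_left (hC _ _ (by linarith) x) (abs_nonneg _)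

section FiniteVolume

variable {μ : Measure (IncrPath d)} (hμ : IsWienerIncrementMeasure μ)
  {W : EuclideanSpace ℝ (Fin d) → ℝ → ℝ} (hW : Continuous (Function.uncurry W))
  (hH1 : EnergyBounded W)
include hμ hW hH1

theorem integrable_exp_neg_mul_pathEnergy (lam : ℝ) {T : ℝ} (hT : 0 < T) :
    Integrable (fun x ↦ Real.exp (-lam * pathEnergy W (-T) T x)) μ := by
  have := hμ.isProbabilityMeasure
  obtain ⟨m, hm⟩ := exists_exp_neg_mul_pathEnergy_le hH1 lam hT
  have := measurable_pathEnergy hW (-T) T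
  exact .of_bound (Measurable.aestronglyMeasurable (by fun_prop)) m (Filter.Eventually.of_forall hm)

theorem isProbabilityMeasure_finiteVolumeMeasure (lam : ℝ) {T : ℝ} (hT : 0 < T) :
    IsProbabilityMeasure (finiteVolumeMeasure μ W lam T) := by
  have := hμ.isProbabilityMeasure
  exact isProbabilityMeasure_tilted (integrable_exp_neg_mul_pathEnergy hμ hW hH1 lam hT)

theorem integrable_finiteVolumeMeasure {g : IncrPath d → ℝ} (hg : Integrable g μ) (lam : ℝ) {T : ℝ}
    (hT : 0 < T) : Integrable g (finiteVolumeMeasure μ W lam T) := by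
  obtain ⟨m, hm⟩ := exists_exp_neg_mul_pathEnergy_le hH1 lam hT
  have := measurable_pathEnergy hW (-T) T
  exact (integrable_tilted_iff (integrable_exp_neg_mul_pathEnergy hμ hW hH1 lam hT) _).2
    (hg.bdd_mul (Measurable.aestronglyMeasurable (by fun_prop)) (Filter.Eventually.of_forall hm))

end FiniteVolume

/-- A second difference of the energy of order `r² A (b - a)` gives a diffusive lower bound for the
variance of `⟨v, X_ab⟩`. -/
theorem le_integral_sq_inner_incr_finiteVolumeMeasure {μ : Measure (IncrPath d)}
    (hμ : IsWienerIncrementMeasure μ)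
    {W : EuclideanSpace ℝ (Fin d) → ℝ → ℝ} (hW : Continuous (Function.uncurry W))
    (hH1 : EnergyBounded W) (lam : ℝ) {T : ℝ} (hT : 0 < T) {a b : ℝ} (hab : a < b)
    {v : EuclideanSpace ℝ (Fin d)} (hv : ‖v‖ = 1) {A : ℝ} (hA : 0 ≤ A)
    (hHA : ∀ r x, |pathEnergy W (-T) T (shiftPath a b v r x)
      + pathEnergy W (-T) T (shiftPath a b v (-r) x) - 2 * pathEnergy W (-T) T x|
      ≤ r ^ 2 * (A * (b - a))) :
    (1 + |lam| * A)⁻¹ * (b - a)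
      ≤ ∫ x, (inner ℝ v (incr a b x)) ^ 2 ∂finiteVolumeMeasure μ W lam T := by
  have := hμ.isProbabilityMeasure
  have := isProbabilityMeasure_finiteVolumeMeasure hμ hW hH1 lam hT
  have hHm := measurable_pathEnergy hW (-T) T
  have hGi := integrable_exp_neg_mul_pathEnergy hμ hW hH1 lam hT
  have hexp : ∀ t, Integrable (fun x ↦ Real.exp (t * inner ℝ v (incr a b x))) μ := fun t ↦ by
    have h := hμ.hasLaw_inner_incr a b v
    have := integrable_exp_mul_gaussianReal (μ := 0) (v := ‖v‖₊ ^ 2 * ‖b - a‖₊) t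
    rw [← h.map_eq] at this
    exact this.comp_aemeasurable h.aemeasurable
  have hexp' := fun t ↦ integrable_finiteVolumeMeasure hμ hW hH1 (hexp t) lam hT
  have key := two_mul_le_integral_sq_of_le_integral_cosh hexp'
    (q := (b - a) / (2 * (1 + |lam| * A))) fun r ↦ ?_
  · refine le_trans (le_of_eq ?_) key
    have : 0 < 1 + |lam| * A := by positivity
    field_simp
  · have hcosh : Integrable (fun x ↦ Real.cosh (r * inner ℝ v (incr a b x)))
        (finiteVolumeMeasure μ W lam T) := by
      refine (((hexp' r).add (hexp' (-r))).div_const 2).congr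
        (Filter.Eventually.of_forall fun ω ↦ ?_)
      simp [Real.cosh_eq]
    have hGc : Integrable (fun x ↦ Real.exp (-lam * pathEnergy W (-T) T x)
        * Real.cosh (r * inner ℝ v (incr a b x))) μ := by
      simpa only [smul_eq_mul] using (integrable_tilted_iff hGi _).1 hcosh
    have hGc0 : ∀ x, 0 ≤ Real.exp (-lam * pathEnergy W (-T) T x)
        * Real.cosh (r * inner ℝ v (incr a b x)) := fun x ↦
      mul_nonneg (Real.exp_pos _).le (Real.cosh_pos _).le
    have h := hμ.exp_mul_lintegral_le hHm hab hv hA hHA lam r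
    rw [← ofReal_integral_eq_lintegral_ofReal hGi
        (Filter.Eventually.of_forall fun x ↦ (Real.exp_pos _).le),
      ← ofReal_integral_eq_lintegral_ofReal hGc
        (Filter.Eventually.of_forall hGc0),
      ← ENNReal.ofReal_mul (Real.exp_pos _).le, ENNReal.ofReal_le_ofReal_iff
        (integral_nonneg hGc0)] at h
    have hZ : 0 < ∫ x, Real.exp (-lam * pathEnergy W (-T) T x) ∂μ := integral_exp_pos hGi
    rw [finiteVolumeMeasure, integral_tilted]
    simp only [smul_eq_mul, div_mul_eq_mul_div, integral_div]
    rw [le_div_iff₀ hZ]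
    refine le_trans ?_ h
    gcongr
    linarith [Real.add_one_le_exp (r ^ 2 * ((b - a) / (2 * (1 + |lam| * A))))]

end IncrPath

theorem mainTheorem6 (d : ℕ) (hd : 1 ≤ d)
    (μ : Measure (IncrPath d)) (hμ : IsWienerIncrementMeasure μ)
    (W : EuclideanSpace ℝ (Fin d) → ℝ → ℝ) (hW : Continuous (Function.uncurry W))
    (hH1 : EnergyBounded W) (hH4 : HessianDecay W) (lam : ℝ) :
    ∃ σ : ℝ, 0 < σ ∧ ∀ T : ℝ, 0 < T → ∀ a b : ℝ,
      Integrable (fun x => ‖incr a b x‖ ^ 2) (finiteVolumeMeasure μ W lam T) ∧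
      σ ^ 2 * |a - b| ≤ ∫ x, ‖incr a b x‖ ^ 2 ∂(finiteVolumeMeasure μ W lam T) ∧
      ∀ v : EuclideanSpace ℝ (Fin d), ‖v‖ = 1 →
        σ ^ 2 * |a - b| ≤
          ∫ x, (inner ℝ v (incr a b x)) ^ 2 ∂(finiteVolumeMeasure μ W lam T) := by
  obtain ⟨hC, K, α, hα, hK⟩ := hH4
  set A := ∫ u : ℝ, 2 * (K / (1 + |u|) ^ α) * u ^ 2
  have hA : 0 ≤ A := integral_nonneg fun u ↦ by
    have := (norm_nonneg (fderiv ℝ (fderiv ℝ fun η ↦ W η u) 0)).trans (hK u 0)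
    positivity
  have hM : 0 < 1 + |lam| * A := by positivity
  have hdir : ∀ T : ℝ, 0 < T → ∀ a b : ℝ, ∀ v : EuclideanSpace ℝ (Fin d), ‖v‖ = 1 →
      √((1 + |lam| * A)⁻¹) ^ 2 * |a - b| ≤
          ∫ x, (inner ℝ v (incr a b x)) ^ 2 ∂(finiteVolumeMeasure μ W lam T) := by
    intro T hT a b v hv
    rw [Real.sq_sqrt (inv_nonneg.2 hM.le)]
    have main : ∀ a b : ℝ, a < b → (1 + |lam| * A)⁻¹ * (b - a) ≤
        ∫ x, (inner ℝ v (incr a b x)) ^ 2 ∂(finiteVolumeMeasure μ W lam T) := fun a b hab ↦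
      le_integral_sq_inner_incr_finiteVolumeMeasure hμ hW hH1 lam hT hab hv hA fun r x ↦
        abs_pathEnergy_second_difference_le hW hC hα hK hab.le hT.le hv r x
    rcases lt_trichotomy a b with hab | rfl | hab
    · rw [abs_sub_comm, abs_of_pos (sub_pos.2 hab)]
      exact main a b hab
    · simpa using integral_nonneg fun x ↦ sq_nonneg _
    · rw [abs_of_pos (sub_pos.2 hab)]
      simpa only [incr_symm b a, inner_neg_right, neg_sq] using main b a hab
  have hint : ∀ T : ℝ, 0 < T → ∀ a b : ℝ,
      Integrable (fun x => ‖incr a b x‖ ^ 2) (finiteVolumeMeasure μ W lam T) := fun T hT a b ↦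
    integrable_finiteVolumeMeasure hμ hW hH1
      ((hμ.hasGaussianLaw_incr a b).memLp_two.integrable_norm_pow two_ne_zero) lam hT
  refine ⟨√((1 + |lam| * A)⁻¹), by positivity, fun T hT a b ↦ ⟨hint T hT a b, ?_, hdir T hT a b⟩⟩
  let v : EuclideanSpace ℝ (Fin d) := EuclideanSpace.single ⟨0, hd⟩ 1
  have hv : ‖v‖ = 1 := by simp [v]
  refine (hdir T hT a b v hv).trans (integral_mono_of_nonneg
    (Filter.Eventually.of_forall fun x ↦ sq_nonneg _) (hint T hT a b)
    (Filter.Eventually.of_forall fun x ↦ ?_))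
  have := abs_real_inner_le_norm v (incr a b x)
  rw [hv, one_mul] at this
  exact sq_le_sq' (abs_le.1 this).1 (abs_le.1 this).2
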